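/- Let $k\ge 1$ and $d\ge 2$ be integers. In the online $b$-matching problem with variable capacities, a finite nonempty set $S$ of servers with capacities $b_s\in\mathbb{N}$, $b_s\ge 1$, is known in advance. Requests $r\in R$ arrive one by one, each revealing its set of adjacent servers, and must be matched immediately and irrevocably to at most one adjacent server, where each server $s$ is matched at most $b_s$ times. The bipartite graph $G=(S\cup R,E)$ is a $(k,d)$-graph if every server $s$ has degree at least $k b_s$ and every request has degree at most $d$. For $b\ge 1$ put \[ c^*(b)=1-\frac1b\left(\sum_{i=1}^{b} i\binom{kb}{b-i}\frac{1}{(d-1)^{b-i}}\right)\left(1-\frac1d\right)^{kb}, \] and $c^*_s=c^*(b_s)$, $c^*_{\min}=c^*(b_{\min})$ with $b_{\min}=\min_{s\in S} b_s$. For a server $s$ with $b=b_s$ and $c=c^*_s$, define $P_i$ ($0\le i\le b-1$) by \[ \left(\frac{d}{d-1}\right)^{kb-i}\left(P_i+\frac{b-i}{bc}-1\right)=\frac{1}{bc}\sum_{j=1}^{b-i} j\binom{kb-i}{b-i-j}\frac{1}{(d-1)^{b-i-j}}, \] and define $V_s(l,\delta)=1$ for $\delta\ge kb$ and, for $0\le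 l\le b$, $l\le\delta<kb$, \[ V_s(l,\delta)=\sum_{i=l}^{b-1}\frac{(-1)^{i-l}}{(d-1)^{i-l}}\binom{\delta-l}{i-l}\left(\frac{d}{d-1}\right)^{\delta-i}\left(P_i+\frac{b-i}{bc}-1\right)+1-\frac{b-l}{bc}. \] The algorithm WeightedAssignment(VC) leaves a request unmatched if it has no adjacent server with remaining capacity, and otherwise matches it to an adjacent server $s$ with remaining capacity for which $b_s\,(V_s(l_s,\delta_s+1)-V_s(l_s,\delta_s))$ is maximal, where $l_s$ (load) and $\delta_s$ (degree) are the numbers of earlier requests matched to $s$ and adjacent to $s$, respectively. Ties are broken arbitrarily. Theorem. WeightedAssignment(VC) is well defined and always produces a $b$-matching. For every server set and every $(k,d)$-graph $G$ with any order of arrival, its size is at least $(\min_{s\in S}c^*_s)\cdot\mathrm{OPT}(G)$, where $\mathrm{OPT}(G)$ is the maximum size of a $b$-matching in $G$. Moreover $\min_{s\in S}c^*_s=c^*_{\min}$. If $k\ge d$, this ratio is optimal: for every finite nonempty set $B$ of positive integers, every deterministic online algorithm that is $c$-competitive on all $(k,d)$-graphs whose set of server capacities is $B$ satisfies $c\le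 c^*(\min B)$. -/

import Mathlib

namespace KDMatching

noncomputable section

/-! ### Online `b`-matching instances

The servers form a finite type `S`, known in advance together with the capacities `b : S → ℕ`.
A request is given by the finite set of its neighbouring servers, and the sequence of arriving
requests is a list `σ`. So `σ` encodes a bipartite graph on `S` and the set
`R = Fin σ.length` of requests, with an edge between `s` and `t` iff `s ∈ σ[t]`, together with the
order of arrival of the requests. -/

section Instances

variable {S : Type*} [DecidableEq S]

/-- The degree of the server `s` in the graph formed by the requests `σ`. -/
def degree (σ : List (Finset S)) (s : S) : ℕ :=
  (Finset.univ.filter fun t : Fin σ.length => s ∈ σ[t]).card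

/-- `(k,d)`-graphs: each server `s` has degree at least `k * b s`, each request at most `d`. -/
def IsKDGraph (k d : ℕ) (b : S → ℕ) (σ : List (Finset S)) : Prop :=
  (∀ s, k * b s ≤ degree σ s) ∧ ∀ N ∈ σ, N.card ≤ d

/-- A set `M` of server-request pairs is a `b`-matching: it consists of edges, every server `s` lies
on at most `b s` of them, and every request on at most one. -/
def IsBMatching (b : S → ℕ) (σ : List (Finset S)) (M : Finset (S × Fin σ.length)) : Prop :=
  (∀ e ∈ M, e.1 ∈ σ[e.2]) ∧
  (∀ s, (M.filter fun e => e.1 = s).card ≤ b s) ∧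
  (∀ t, (M.filter fun e => e.2 = t).card ≤ 1)

open Classical in
/-- The size of a maximum `b`-matching. -/
def opt [Fintype S] (b : S → ℕ) (σ : List (Finset S)) : ℕ :=
  ((Finset.univ : Finset (Finset (S × Fin σ.length))).filter (IsBMatching b σ)).sup Finset.card

/-- A deterministic online rule for the server set `S`: from the list of earlier requests and the
new request it determines the server to which the new request is matched (`none`: not matched).
The earlier decisions are functions of the earlier requests, so they need not be an argument. -/
abbrev OnlineRule (S : Type*) := List (Finset S) → Finset S → Option S

/-- The set of server-request pairs that the rule `A` selects on the request sequence `σ`. -/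
def OnlineRule.output [Fintype S] (A : OnlineRule S) (σ : List (Finset S)) :
    Finset (S × Fin σ.length) :=
  Finset.univ.filter fun e => A (σ.take e.2) σ[e.2] = some e.1

/-- The load of `s`: the number of requests matched to `s` by `A` after serving `σ`. -/
def OnlineRule.load (A : OnlineRule S) (σ : List (Finset S)) (s : S) : ℕ :=
  (Finset.univ.filter fun t : Fin σ.length => A (σ.take t) σ[t] = some s).card

end Instances

/-- A deterministic online algorithm: for every server set `{0, …, n-1}` with given capacities,
an online rule. -/
abbrev OnlineAlgorithm := (n : ℕ) → (Fin n → ℕ) → OnlineRule (Fin n)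

/-- On every `(k,d)`-graph the algorithm `A` produces a `b`-matching. -/
def OnlineAlgorithm.IsValid (k d : ℕ) (A : OnlineAlgorithm) : Prop :=
  ∀ (n : ℕ) (b : Fin n → ℕ), (∀ s, 0 < b s) → ∀ σ, IsKDGraph k d b σ →
    IsBMatching b σ ((A n b).output σ)

/-- `A` is `c`-competitive on the `(k,d)`-graphs whose set of server capacities is `B`. -/
def OnlineAlgorithm.IsCompetitiveOn (k d : ℕ) (B : Finset ℕ) (c : ℝ) (A : OnlineAlgorithm) :
    Prop :=
  ∀ (n : ℕ) (b : Fin n → ℕ), Finset.univ.image b = B → ∀ σ, IsKDGraph k d b σ →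
    c * (opt b σ : ℝ) ≤ (((A n b).output σ).card : ℝ)

/-! ### The ratio `c*` and the function `V` for a single capacity `b` -/

/-- `c* = 1 - (1/b) (∑_{i=1}^b i C(kb, b-i) / (d-1)^(b-i)) (1 - 1/d)^(kb)`. -/
def cStar (k d b : ℕ) : ℝ :=
  1 - 1 / (b : ℝ) *
    (∑ i ∈ Finset.Icc 1 b, (i : ℝ) * ((k * b).choose (b - i) : ℝ) *
      (1 / ((d : ℝ) - 1) ^ (b - i))) *
    (1 - 1 / (d : ℝ)) ^ (k * b)

/-- The diagonal values `P_l = V(l,l)` for `l < b`, determined by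
`(d/(d-1))^(kb-l) (P_l + (b-l)/(b c*) - 1)
  = 1/(b c*) ∑_{i=1}^{b-l} i C(kb-l, b-l-i) / (d-1)^(b-l-i)`. -/
def P (k d b l : ℕ) : ℝ :=
  1 - ((b : ℝ) - l) / (b * cStar k d b) +
    ((d : ℝ) / (d - 1))⁻¹ ^ (k * b - l) *
      (1 / (b * cStar k d b) *
        ∑ i ∈ Finset.Icc 1 (b - l), (i : ℝ) * ((k * b - l).choose (b - l - i) : ℝ) *
          (1 / ((d : ℝ) - 1) ^ (b - l - i)))

/-- The value `V(l,δ)` of a server of capacity `b` with load `l` and current degree `δ`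
(where `l ≤ b` and `l ≤ δ`). It is `1` for `δ ≥ kb`; the sum is empty and `V(b,δ) = 1` for
`l = b`. -/
def V (k d b l δ : ℕ) : ℝ :=
  if k * b ≤ δ then 1
  else
    (∑ i ∈ Finset.Ico l b,
      (-1 : ℝ) ^ (i - l) * (1 / ((d : ℝ) - 1) ^ (i - l)) * ((δ - l).choose (i - l) : ℝ) *
        ((d : ℝ) / (d - 1)) ^ ((δ : ℤ) - i) *
        (P k d b i + ((b : ℝ) - i) / (b * cStar k d b) - 1)) +
      1 - ((b : ℝ) - l) / (b * cStar k d b)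

/-! ### The algorithm -/

/-- The score `b_s (V_s(l_s, δ_s + 1) - V_s(l_s, δ_s))` of the server `s` after the requests `σ`
have been served by the rule `A`; `V_s` is the function `V` for the capacity `b_s`. -/
def score {S : Type*} [DecidableEq S] (k d : ℕ) (b : S → ℕ) (A : OnlineRule S)
    (σ : List (Finset S)) (s : S) : ℝ :=
  (b s : ℝ) *
    (V k d (b s) (A.load σ s) (degree σ s + 1) - V k d (b s) (A.load σ s) (degree σ s))

/-- The neighbours of the new request `N` that have remaining capacity. -/
def eligible {S : Type*} [DecidableEq S] (b : S → ℕ) (A : OnlineRule S)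
    (σ : List (Finset S)) (N : Finset S) : Finset S :=
  N.filter fun s => A.load σ s < b s

/-- `A` is the algorithm WeightedAssignment(VC), with an arbitrary (deterministic) way of
breaking ties: a request without eligible neighbour is not matched, any other request is
matched to an eligible neighbour of maximum score. -/
def IsWeightedAssignmentVC (k d : ℕ) (A : OnlineAlgorithm) : Prop :=
  ∀ (n : ℕ) (b : Fin n → ℕ) (σ : List (Finset (Fin n))) (N : Finset (Fin n)),
    (eligible b (A n b) σ N = ∅ → A n b σ N = none) ∧
    ((eligible b (A n b) σ N).Nonempty →
      ∃ s ∈ eligible b (A n b) σ N, A n b σ N = some s ∧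
        ∀ s' ∈ eligible b (A n b) σ N,
          score k d b (A n b) σ s' ≤ score k d b (A n b) σ s)

end

end KDMatching

/-!
Let `X_n` be binomial with `n` trials of success probability `1 / d`, and put
`gain m n = E[min(m, X_n)]`. Conditioning on one trial gives
`d * gain (m+1) (n+1) = 1 + gain m n + (d-1) * gain (m+1) n`. In these terms
`b * c*(b) = gain b (k*b)` and `V l δ = 1 - gain (b-l) (k*b-δ) / (b * c*(b))`.

For a constant `c ≤ c*_s` the potential `∑ s, (c * b_s * V_s - l_s)` is `0` at the start, and by
the recursion no request raises it, because the chosen server has at least the average increase of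
`b_s * V_s` among at most `d` neighbours. At the end every `V_s` is `1`, so the matching has size at
least `c * ∑ s, b_s`. Moreover `c*(b)` is the value at `1 / d` of the Bernstein polynomial of degree
`k*b` of the concave function `u ↦ min 1 (k*u)`, hence increasing in `b`.

For optimality the adversary keeps requesting `d` servers that agree in capacity, load and degree.
The same recursion, read in the other direction, says that the total load plus the total gain still
to come does not increase. The adversary gets stuck only when boundedly many servers are left
incomplete, while for `k ≥ d` Hall's theorem gives a matching that exhausts all capacities; with
many copies of the smallest capacity the bounded error becomes negligible.
-/

namespace KDMatching

open Finset

/-! ### Binomial sums -/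

section BinomialSum

/-- The binomial sum `∑ i, C(n,i) x^i y^(n-i) φ i`, that is, the `n`-th power of the operator
`φ ↦ x φ(· + 1) + y φ` applied to `φ`, evaluated at `0`. For `x = p` and `y = 1 - p` it is the
expectation `E[φ(X)]` for a binomial variable `X` with `n` trials of success probability `p`. -/
def binomialSum {R : Type*} [CommSemiring R] (x y : R) (n : ℕ) (φ : ℕ → R) : R :=
  ∑ ij ∈ antidiagonal n, (n.choose ij.1 : R) * (x ^ ij.1 * y ^ ij.2 * φ ij.1)

section CommSemiring

variable {R : Type*} [CommSemiring R] (x y : R) (n : ℕ) (φ ψ : ℕ → R)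

theorem binomialSum_zero_right : binomialSum x y 0 φ = φ 0 := by simp [binomialSum]

theorem binomialSum_succ :
    binomialSum x y (n + 1) φ =
      x * binomialSum x y n (fun i => φ (i + 1)) + y * binomialSum x y n φ := by
  simp only [binomialSum]
  rw [sum_antidiagonal_choose_succ_mul (fun i j => x ^ i * y ^ j * φ i), add_comm, mul_sum, mul_sum]
  congr 1
  · refine sum_congr rfl fun ij hij => ?_
    rw [← Nat.choose_symm_of_eq_add (mem_antidiagonal.1 hij).symm]
    ring
  · exact sum_congr rfl fun ij _ => by ring

theorem binomialSum_add :
    binomialSum x y n (fun i => φ i + ψ i) = binomialSum x y n φ + binomialSum x y n ψ := by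
  simp only [binomialSum, mul_add, sum_add_distrib]

theorem binomialSum_const_mul (a : R) :
    binomialSum x y n (fun i => a * φ i) = a * binomialSum x y n φ := by
  simp only [binomialSum, mul_sum]
  exact sum_congr rfl fun _ _ => by ring

theorem binomialSum_const (a : R) : binomialSum x y n (fun _ => a) = (x + y) ^ n * a := by
  induction n with
  | zero => simp [binomialSum_zero_right]
  | succ n ih => rw [binomialSum_succ, ih]; ring

theorem binomialSum_succ_natCast_mul_pred :
    binomialSum x y (n + 1) (fun i => i * φ (i - 1)) = (n + 1) * (x * binomialSum x y n φ) := by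
  simp only [binomialSum, Nat.sum_antidiagonal_succ, mul_sum]
  simp only [Nat.cast_zero, zero_mul, mul_zero, zero_add, Nat.add_sub_cancel]
  refine sum_congr rfl fun ij _ => ?_
  have absorb : ((n + 1).choose (ij.1 + 1) : R) * (ij.1 + 1 : ℕ) = (n + 1) * n.choose ij.1 := by
    exact_mod_cast congrArg (Nat.cast (R := R)) (Nat.add_one_mul_choose_eq n ij.1).symm
  calc _ = ((n + 1).choose (ij.1 + 1) : R) * (ij.1 + 1 : ℕ) *
        (x ^ (ij.1 + 1) * y ^ ij.2 * φ ij.1) := by ring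
    _ = _ := by rw [absorb]; ring

theorem binomialSum_succ_natCast_sub_mul :
    binomialSum x y (n + 1) (fun i => (n + 1 - i : ℕ) * φ i) =
      (n + 1) * (y * binomialSum x y n φ) := by
  simp only [binomialSum, Nat.sum_antidiagonal_succ', mul_sum]
  simp only [Nat.sub_self, Nat.cast_zero, zero_mul, mul_zero, zero_add]
  refine sum_congr rfl fun ij _ => ?_
  have absorb : ((n + 1).choose ij.1 : R) * (n + 1 - ij.1 : ℕ) = (n + 1) * n.choose ij.1 := by
    exact_mod_cast congrArg (Nat.cast (R := R))
      ((Nat.choose_mul_succ_eq n ij.1).symm.trans (mul_comm _ _))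
  calc _ = ((n + 1).choose ij.1 : R) * (n + 1 - ij.1 : ℕ) *
        (x ^ ij.1 * y ^ (ij.2 + 1) * φ ij.1) := by ring
    _ = _ := by rw [absorb]; ring

variable {x y}

/-- Averaging over which of the `n + 1` trials is left out. -/
theorem succ_mul_binomialSum (hxy : x + y = 1) :
    (n + 1) * binomialSum x y n φ =
      binomialSum x y (n + 1) fun i => i * φ (i - 1) + (n + 1 - i : ℕ) * φ i := by
  rw [binomialSum_add, binomialSum_succ_natCast_mul_pred, binomialSum_succ_natCast_sub_mul,
    ← mul_add, ← add_mul, hxy, one_mul]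

theorem eq_binomialSum_of_recurrence {K : ℕ} {g : ℕ → ℕ → R}
    (hg : ∀ e l, l + e < K → g (e + 1) l = x * g e (l + 1) + y * g e l) (e l : ℕ)
    (hK : l + e ≤ K) : g e l = binomialSum x y e fun i => g 0 (l + i) := by
  induction e generalizing l with
  | zero => rw [binomialSum_zero_right, add_zero]
  | succ e ih =>
    rw [hg e l (by omega), ih l (by omega), ih (l + 1) (by omega), binomialSum_succ]
    simp only [add_assoc, add_comm 1]

end CommSemiring

theorem binomialSum_eq_sum_range {F : Type*} [Field F] {x y : F} (hy : y ≠ 0) (n : ℕ) {m : ℕ}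
    {φ : ℕ → F} (hφ : ∀ i ≥ m, φ i = 0) :
    binomialSum x y n φ = y ^ n * ∑ i ∈ range m, (n.choose i : F) * (x / y) ^ i * φ i := by
  set u : ℕ → F := fun i => (n.choose i : F) * (x / y) ^ i * φ i with hu
  have u_eq_zero_of_lt : ∀ i ≥ n + 1, u i = 0 := fun i hi => by
    simp [hu, Nat.choose_eq_zero_of_lt (show n < i from hi)]
  have u_eq_zero_of_le : ∀ i ≥ m, u i = 0 := fun i hi => by simp [hu, hφ i hi]
  have sum_eq : ∑ i ∈ range (n + 1), u i = ∑ i ∈ range m, u i := by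
    rcases le_total (n + 1) m with h | h
    · exact (eventually_constant_sum u_eq_zero_of_lt h).symm
    · exact eventually_constant_sum u_eq_zero_of_le h
  rw [← sum_eq, ← Nat.sum_antidiagonal_eq_sum_range_succ_mk (fun ij => u ij.1), mul_sum]
  refine sum_congr rfl fun ij hij => ?_
  simp only [hu, ← mem_antidiagonal.1 hij, pow_add, div_pow]
  field_simp

section Ordered

variable {R : Type*} [CommSemiring R] [PartialOrder R] [IsOrderedRing R] {x y : R} {n : ℕ}
  {φ ψ : ℕ → R}

theorem binomialSum_le_binomialSum (hx : 0 ≤ x) (hy : 0 ≤ y) (h : ∀ i ≤ n, φ i ≤ ψ i) :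
    binomialSum x y n φ ≤ binomialSum x y n ψ :=
  sum_le_sum fun ij hij => by
    have := h ij.1 (Nat.le.intro (mem_antidiagonal.1 hij))
    gcongr

theorem binomialSum_nonneg (hx : 0 ≤ x) (hy : 0 ≤ y) (h : ∀ i, 0 ≤ φ i) :
    0 ≤ binomialSum x y n φ :=
  sum_nonneg fun ij _ => by
    have := h ij.1
    positivity

end Ordered

theorem natCast_mul_add_sub_mul_le_of_concaveOn {φ : ℝ → ℝ}
    (hφ : ConcaveOn ℝ (Set.Icc 0 1) φ) {n i : ℕ} (hn : 0 < n) (hi : i ≤ n + 1) :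
    i * φ ((i - 1 : ℕ) / n) + (n + 1 - i : ℕ) * φ (i / n) ≤ (n + 1) * φ (i / (n + 1 : ℕ)) := by
  have hn' : (0 : ℝ) < n := by exact_mod_cast hn
  rcases hi.eq_or_lt with rfl | hi
  · have : (n : ℝ) + 1 ≠ 0 := by positivity
    simp [hn'.ne', this]
  rcases i with _ | i
  · simp
  have hi' : (i : ℝ) + 1 ≤ n := by exact_mod_cast Nat.le_of_lt_succ hi
  have mem_Icc : ∀ j : ℝ, 0 ≤ j → j ≤ n → j / n ∈ Set.Icc (0 : ℝ) 1 := fun j h0 h1 =>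
    ⟨by positivity, (div_le_one hn').2 h1⟩
  have concavity := hφ.2 (mem_Icc i (by positivity) (by linarith))
    (mem_Icc (i + 1) (by positivity) hi') (by positivity : (0 : ℝ) ≤ (i + 1) / (n + 1))
    (div_nonneg (by linarith) (by positivity) : (0 : ℝ) ≤ (n - i) / (n + 1))
    (by field_simp; ring)
  have barycenter : ((i : ℝ) + 1) / (n + 1) * (i / n) + (n - i) / (n + 1) * ((i + 1) / n) =
      (i + 1) / (n + 1) := by
    field_simp
    ring
  rw [smul_eq_mul, smul_eq_mul, smul_eq_mul, smul_eq_mul, barycenter] at concavity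
  rw [Nat.cast_sub hi.le, Nat.add_sub_cancel]
  push_cast
  calc ((i : ℝ) + 1) * φ (i / n) + (n + 1 - (i + 1)) * φ ((i + 1) / n)
      = (n + 1) * ((i + 1) / (n + 1) * φ (i / n) + (n - i) / (n + 1) * φ ((i + 1) / n)) := by
        field_simp
        ring
    _ ≤ (n + 1) * φ ((i + 1) / (n + 1)) := by gcongr

theorem binomialSum_div_le_succ_of_concaveOn {φ : ℝ → ℝ} (hφ : ConcaveOn ℝ (Set.Icc 0 1) φ)
    {p : ℝ} (hp : 0 ≤ p) (hp1 : p ≤ 1) {n : ℕ} (hn : 0 < n) :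
    binomialSum p (1 - p) n (fun i => φ (i / n)) ≤
      binomialSum p (1 - p) (n + 1) fun i => φ (i / (n + 1 : ℕ)) := by
  refine le_of_mul_le_mul_left ?_ (by positivity : (0 : ℝ) < n + 1)
  rw [succ_mul_binomialSum _ _ (add_sub_cancel p 1), ← binomialSum_const_mul]
  exact binomialSum_le_binomialSum hp (sub_nonneg.2 hp1) fun i hi =>
    natCast_mul_add_sub_mul_le_of_concaveOn hφ hn hi

end BinomialSum

/-! ### The expected gain and the value function -/

section Gain

/-- The expectation `E[min(m, X)]` for a binomial variable `X` with `n` trials of success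
probability `p`. For `p = 1 / d` it is the load that a server with `m` free places gains from `n`
further requests when the algorithm and the adversary both play optimally. -/
noncomputable def gain (p : ℝ) (m n : ℕ) : ℝ := binomialSum p (1 - p) n fun i => (min m i : ℕ)

theorem gain_zero_left (p : ℝ) (n : ℕ) : gain p 0 n = 0 := by
  simp [gain, binomialSum_const]

theorem gain_zero_right (p : ℝ) (m : ℕ) : gain p m 0 = 0 := by
  simp [gain, binomialSum_zero_right]

theorem gain_succ_succ (p : ℝ) (m n : ℕ) :
    gain p (m + 1) (n + 1) = p * (1 + gain p m n) + (1 - p) * gain p (m + 1) n := by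
  have min_succ : ∀ i : ℕ, ((min (m + 1) (i + 1) : ℕ) : ℝ) = 1 + (min m i : ℕ) := fun i => by
    rw [Nat.add_min_add_right, Nat.cast_succ, add_comm]
  simp only [gain, binomialSum_succ, min_succ]
  rw [binomialSum_add, binomialSum_const, add_sub_cancel, one_pow, one_mul]

theorem gain_nonneg {p : ℝ} (hp : 0 ≤ p) (hp1 : p ≤ 1) (m n : ℕ) : 0 ≤ gain p m n :=
  binomialSum_nonneg hp (sub_nonneg.2 hp1) fun _ => Nat.cast_nonneg _

theorem gain_le_succ_right {p : ℝ} (hp : 0 ≤ p) (hp1 : p ≤ 1) (m n : ℕ) :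
    gain p m n ≤ gain p m (n + 1) := by
  have shift : gain p m n ≤ binomialSum p (1 - p) n fun i => ((min m (i + 1) : ℕ) : ℝ) :=
    binomialSum_le_binomialSum hp (sub_nonneg.2 hp1) fun i _ =>
      Nat.cast_le.2 (min_le_min_left m (Nat.le_succ i))
  calc gain p m n = p * gain p m n + (1 - p) * gain p m n := by ring
    _ ≤ p * binomialSum p (1 - p) n (fun i => ((min m (i + 1) : ℕ) : ℝ)) +
        (1 - p) * gain p m n := by gcongr
    _ = gain p m (n + 1) := by simp only [gain, binomialSum_succ]

theorem gain_pos {p : ℝ} (hp : 0 < p) (hp1 : p ≤ 1) {m n : ℕ} (hm : 0 < m) (hn : 0 < n) :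
    0 < gain p m n := by
  obtain ⟨m, rfl⟩ := Nat.exists_eq_succ_of_ne_zero hm.ne'
  obtain ⟨n, rfl⟩ := Nat.exists_eq_succ_of_ne_zero hn.ne'
  have h1 := gain_nonneg hp.le hp1 m n
  have h2 := mul_nonneg (sub_nonneg.2 hp1) (gain_nonneg hp.le hp1 (m + 1) n)
  rw [gain_succ_succ]
  positivity

theorem sub_gain (p : ℝ) (m n : ℕ) :
    m - gain p m n = binomialSum p (1 - p) n fun i => (m - i : ℕ) := by
  have sub_add_min : ∀ i : ℕ, ((m - i : ℕ) : ℝ) + (min m i : ℕ) = m := fun i => by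
    rw [← Nat.cast_add, Nat.sub_add_min_cancel]
  rw [sub_eq_iff_eq_add, gain, ← binomialSum_add]
  simp only [sub_add_min]
  rw [binomialSum_const, add_sub_cancel, one_pow, one_mul]

theorem sub_gain_succ_succ (p : ℝ) (m n : ℕ) :
    (m + 1 : ℕ) - gain p (m + 1) (n + 1) =
      p * (m - gain p m n) + (1 - p) * ((m + 1 : ℕ) - gain p (m + 1) n) := by
  rw [gain_succ_succ]
  push_cast
  ring

theorem sum_Icc_mul_choose_mul_pow {p : ℝ} (hp1 : p ≠ 1) (m n : ℕ) :
    (∑ i ∈ Icc 1 m, (i : ℝ) * (n.choose (m - i) : ℝ) * (p / (1 - p)) ^ (m - i)) * (1 - p) ^ n =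
      m - gain p m n := by
  rw [sub_gain, binomialSum_eq_sum_range (sub_ne_zero.2 hp1.symm) n (m := m)
    (fun i hi => by simp [Nat.sub_eq_zero_of_le hi]), mul_comm]
  congr 1
  refine sum_nbij' (m - ·) (m - ·) ?_ ?_ ?_ ?_ ?_ <;>
    simp only [mem_Icc, mem_range] <;> intro i hi
  · omega
  · omega
  · omega
  · omega
  · rw [Nat.sub_sub_self hi.2]
    ring

end Gain

section Value

variable {k d b : ℕ}

theorem one_div_natCast_mem_Ioo (hd : 2 ≤ d) : 1 / (d : ℝ) ∈ Set.Ioo 0 1 := by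
  have hd' : (1 : ℝ) < d := by exact_mod_cast hd
  exact ⟨by positivity, (div_lt_one (by positivity)).2 hd'⟩

theorem natCast_mul_gain_succ_succ (hd : d ≠ 0) (m n : ℕ) :
    d * gain (1 / d) (m + 1) (n + 1) =
      1 + gain (1 / d) m n + (d - 1) * gain (1 / d) (m + 1) n := by
  rw [gain_succ_succ]
  field_simp

theorem sum_Icc_mul_choose_mul_one_div_pow (hd : 2 ≤ d) (m n : ℕ) :
    (∑ i ∈ Icc 1 m, (i : ℝ) * (n.choose (m - i) : ℝ) * (1 / ((d : ℝ) - 1) ^ (m - i))) *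
      (1 - 1 / (d : ℝ)) ^ n = m - gain (1 / d) m n := by
  have odds : (1 / (d : ℝ)) / (1 - 1 / d) = 1 / (d - 1) := by field_simp
  rw [← sum_Icc_mul_choose_mul_pow (one_div_natCast_mem_Ioo hd).2.ne, odds]
  simp only [one_div_pow]

theorem mul_cStar (k : ℕ) (hd : 2 ≤ d) (hb : 0 < b) :
    b * cStar k d b = gain (1 / d) b (k * b) := by
  rw [cStar, mul_assoc, sum_Icc_mul_choose_mul_one_div_pow hd]
  field_simp
  ring

theorem cStar_pos (hk : 1 ≤ k) (hd : 2 ≤ d) (hb : 0 < b) : 0 < cStar k d b := by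
  obtain ⟨hp, hp1⟩ := one_div_natCast_mem_Ioo hd
  have h := gain_pos hp hp1.le hb (Nat.mul_pos hk hb)
  rw [← mul_cStar k hd hb] at h
  exact pos_of_mul_pos_right h b.cast_nonneg

theorem cStar_eq_binomialSum (hk : 1 ≤ k) (hd : 2 ≤ d) (hb : 0 < b) :
    cStar k d b =
      binomialSum (1 / (d : ℝ)) (1 - 1 / d) (k * b) fun i => min 1 (k * (i / (k * b : ℕ))) := by
  have hb' : (0 : ℝ) < b := by exact_mod_cast hb
  have : (0 : ℝ) < k := by exact_mod_cast hk
  refine mul_left_cancel₀ hb'.ne' ?_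
  rw [mul_cStar k hd hb, ← binomialSum_const_mul, gain]
  congr with i
  rw [Nat.cast_min, mul_min_of_nonneg _ _ hb'.le, mul_one]
  push_cast
  congr 1
  field_simp

theorem cStar_mono {b' : ℕ} (hk : 1 ≤ k) (hd : 2 ≤ d) (hb : 0 < b) (h : b ≤ b') :
    cStar k d b ≤ cStar k d b' := by
  obtain ⟨hp, hp1⟩ := one_div_natCast_mem_Ioo hd
  have concave : ConcaveOn ℝ (Set.Icc 0 1) fun u : ℝ => min 1 (k * u) :=
    (concaveOn_const 1 (convex_Icc 0 1)).inf
      ((LinearMap.mulLeft ℝ (k : ℝ)).concaveOn (convex_Icc 0 1))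
  rw [cStar_eq_binomialSum hk hd hb, cStar_eq_binomialSum hk hd (hb.trans_le h)]
  refine Nat.le_induction le_rfl (fun n hn ih => ih.trans ?_) _ (Nat.mul_le_mul_left k h)
  exact binomialSum_div_le_succ_of_concaveOn concave hp.le hp1.le
    ((Nat.mul_pos hk hb).trans_le hn)

theorem inf'_cStar {ι : Type*} (hk : 1 ≤ k) (hd : 2 ≤ d) {s : Finset ι} (hs : s.Nonempty)
    {b : ι → ℕ} (hb : ∀ i ∈ s, 0 < b i) :
    s.inf' hs (fun i => cStar k d (b i)) = cStar k d (s.inf' hs b) := by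
  obtain ⟨i, hi, h⟩ := exists_mem_eq_inf' hs b
  rw [h]
  exact le_antisymm (inf'_le _ hi) (le_inf' _ _ fun j hj => cStar_mono hk hd (hb i hi)
    (h ▸ inf'_le b hj))

theorem P_add_sub_one (hd : 2 ≤ d) (l : ℕ) :
    P k d b l + ((b : ℝ) - l) / (b * cStar k d b) - 1 =
      ((b - l : ℕ) - gain (1 / d) (b - l) (k * b - l)) / (b * cStar k d b) := by
  have inv_ratio : ((d : ℝ) / (d - 1))⁻¹ = 1 - 1 / d := by
    rw [inv_div]
    field_simp
  rw [P, inv_ratio, ← sum_Icc_mul_choose_mul_one_div_pow hd]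
  ring

theorem sub_gain_add_one {K e l : ℕ} (hd : 2 ≤ d) (b : ℕ) (h : l + e < K) :
    (b - l : ℕ) - gain (1 / d) (b - l) (K - (l + (e + 1))) =
      -(1 / ((d : ℝ) - 1)) *
          ((b - (l + 1) : ℕ) - gain (1 / d) (b - (l + 1)) (K - (l + 1 + e))) +
        d / (d - 1) * ((b - l : ℕ) - gain (1 / d) (b - l) (K - (l + e))) := by
  have hd' : (1 : ℝ) < d := by exact_mod_cast hd
  have h1 : (d : ℝ) - 1 ≠ 0 := by linarith
  rcases le_or_gt b l with hbl | hbl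
  · simp [Nat.sub_eq_zero_of_le hbl, Nat.sub_eq_zero_of_le (hbl.trans l.le_succ), gain_zero_left]
  · obtain ⟨m, hm⟩ : ∃ m, b - l = m + 1 := ⟨b - l - 1, by omega⟩
    obtain ⟨n, hn⟩ : ∃ n, K - (l + e) = n + 1 := ⟨K - (l + e) - 1, by omega⟩
    rw [hm, hn, show b - (l + 1) = m by omega, show K - (l + (e + 1)) = n by omega,
      show K - (l + 1 + e) = n by omega, sub_gain_succ_succ]
    field_simp
    ring

/-- The alternating sum arises by solving the recursion of `gain` for the larger degree, which
expresses degree `δ` through the diagonal states of degree equal to load. -/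
theorem sum_Ico_P {l δ : ℕ} (hd : 2 ≤ d) (hlδ : l ≤ δ) (hδ : δ ≤ k * b) :
    ∑ i ∈ Ico l b, (-1 : ℝ) ^ (i - l) * (1 / ((d : ℝ) - 1) ^ (i - l)) *
        ((δ - l).choose (i - l) : ℝ) * ((d : ℝ) / (d - 1)) ^ ((δ : ℤ) - i) *
        (P k d b i + ((b : ℝ) - i) / (b * cStar k d b) - 1) =
      ((b - l : ℕ) - gain (1 / d) (b - l) (k * b - δ)) / (b * cStar k d b) := by
  have hd' : (1 : ℝ) < d := by exact_mod_cast hd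
  have h1 : (d : ℝ) - 1 ≠ 0 := by linarith
  set y : ℝ := d / (d - 1) with hy
  have hy0 : y ≠ 0 := by positivity
  set g : ℕ → ℕ → ℝ := fun e l =>
    ((b - l : ℕ) - gain (1 / d) (b - l) (k * b - (l + e))) / (b * cStar k d b) with hg
  have recurrence : ∀ e l, l + e < k * b →
      g (e + 1) l = -(1 / ((d : ℝ) - 1)) * g e (l + 1) + y * g e l := by
    intro e l hle
    simp only [hg, hy, sub_gain_add_one hd b hle]
    ring
  obtain ⟨e, rfl⟩ := Nat.exists_eq_add_of_le hlδ
  rw [show ((b - l : ℕ) - gain (1 / d) (b - l) (k * b - (l + e))) / (b * cStar k d b) = g e l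
    from rfl, eq_binomialSum_of_recurrence recurrence e l hδ,
    binomialSum_eq_sum_range hy0 e (m := b - l) (fun i hi => by
      simp [hg, show b - (l + i) = 0 by omega, gain_zero_left]),
    sum_Ico_eq_sum_range, mul_sum]
  refine sum_congr rfl fun i _ => ?_
  have zpow_eq : y ^ (((l + e : ℕ) : ℤ) - ((l + i : ℕ) : ℤ)) = y ^ e / y ^ i := by
    rw [← zpow_natCast, ← zpow_natCast, ← zpow_sub₀ hy0]
    congr 1
    push_cast
    ring
  simp only [Nat.add_sub_cancel_left, P_add_sub_one hd, zpow_eq, hg, add_zero, neg_div, div_pow,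
    one_pow, neg_pow (1 / ((d : ℝ) - 1) / y)]
  field_simp

theorem V_eq_one_sub_gain {l δ : ℕ} (hd : 2 ≤ d) (hl : l ≤ b) (hlδ : l ≤ δ) :
    V k d b l δ = 1 - gain (1 / d) (b - l) (k * b - δ) / (b * cStar k d b) := by
  unfold V
  split_ifs with hδ
  · simp [Nat.sub_eq_zero_of_le hδ, gain_zero_right]
  · rw [sum_Ico_P hd hlδ (le_of_not_ge hδ), Nat.cast_sub hl]
    ring

theorem V_zero_zero (hk : 1 ≤ k) (hd : 2 ≤ d) (hb : 0 < b) : V k d b 0 0 = 0 := by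
  have bc_pos : (0 : ℝ) < b * cStar k d b := mul_pos (Nat.cast_pos.2 hb) (cStar_pos hk hd hb)
  rw [V_eq_one_sub_gain hd b.zero_le le_rfl, Nat.sub_zero, Nat.sub_zero, ← mul_cStar k hd hb,
    div_self bc_pos.ne', sub_self]

theorem V_of_load_eq_capacity {δ : ℕ} (hd : 2 ≤ d) (hδ : b ≤ δ) : V k d b b δ = 1 := by
  simp [V_eq_one_sub_gain hd le_rfl hδ, gain_zero_left]

theorem V_le_succ_right {l δ : ℕ} (hk : 1 ≤ k) (hd : 2 ≤ d) (hb : 0 < b) (hl : l ≤ b)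
    (hlδ : l ≤ δ) : V k d b l δ ≤ V k d b l (δ + 1) := by
  obtain ⟨hp, hp1⟩ := one_div_natCast_mem_Ioo hd
  have hc := cStar_pos hk hd hb
  rw [V_eq_one_sub_gain hd hl hlδ, V_eq_one_sub_gain hd hl (hlδ.trans δ.le_succ)]
  gcongr
  exact monotone_nat_of_le_succ (gain_le_succ_right hp.le hp1.le (b - l))
    (Nat.sub_le_sub_left δ.le_succ _)

theorem V_succ_succ_sub_add_mul_le {l δ : ℕ} (hk : 1 ≤ k) (hd : 2 ≤ d) (hl : l < b)
    (hlδ : l ≤ δ) :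
    b * (V k d b (l + 1) (δ + 1) - V k d b l (δ + 1)) +
      d * (b * (V k d b l (δ + 1) - V k d b l δ)) ≤ 1 / cStar k d b := by
  have hb : 0 < b := l.zero_le.trans_lt hl
  have hc := cStar_pos hk hd hb
  rw [V_eq_one_sub_gain hd hl.le hlδ, V_eq_one_sub_gain hd hl.le (hlδ.trans δ.le_succ),
    V_eq_one_sub_gain hd hl (Nat.succ_le_succ hlδ)]
  rcases le_or_gt (k * b) δ with hδ | hδ
  · simp [Nat.sub_eq_zero_of_le hδ, Nat.sub_eq_zero_of_le (hδ.trans δ.le_succ), gain_zero_right,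
      hc.le]
  · obtain ⟨m, hm⟩ : ∃ m, b - l = m + 1 := ⟨b - l - 1, by omega⟩
    obtain ⟨n, hn⟩ : ∃ n, k * b - δ = n + 1 := ⟨k * b - δ - 1, by omega⟩
    rw [hm, hn, show b - (l + 1) = m by omega, show k * b - (δ + 1) = n by omega]
    refine le_of_eq ?_
    field_simp
    linear_combination natCast_mul_gain_succ_succ (by omega : d ≠ 0) m n

end Value

/-! ### Request sequences and feasible rules -/

section Requests

theorem card_filter_take_append_singleton {α : Type*} (R : List α → α → Prop)
    [∀ l a, Decidable (R l a)] (l : List α) (a : α) :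
    (univ.filter fun t : Fin (l ++ [a]).length => R ((l ++ [a]).take t) (l ++ [a])[t]).card =
      (univ.filter fun t : Fin l.length => R (l.take t) l[t]).card + if R l a then 1 else 0 := by
  have length_eq : (l ++ [a]).length = l.length + 1 := by simp
  rw [card_filter, card_filter,
    Fintype.sum_equiv (finCongr length_eq) _ (fun t : Fin (l.length + 1) =>
      if R ((l ++ [a]).take t) ((l ++ [a])[(t : ℕ)]'(t.2.trans_eq length_eq.symm)) then 1 else 0)
      (fun t => by simp),
    Fin.sum_univ_castSucc]
  congr 1
  · exact sum_congr rfl fun t _ => by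
      simp [List.take_append_of_le_length t.2.le, List.getElem_append_left]
  · simp

variable {S : Type*} [DecidableEq S]

theorem degree_append_singleton (σ : List (Finset S)) (N : Finset S) (s : S) :
    degree (σ ++ [N]) s = degree σ s + if s ∈ N then 1 else 0 :=
  card_filter_take_append_singleton (fun _ N => s ∈ N) σ N

theorem degree_eq_countP (σ : List (Finset S)) (s : S) : degree σ s = σ.countP (s ∈ ·) := by
  induction σ using List.reverseRecOn with
  | nil => simp [degree]
  | append_singleton σ N ih => simp [degree_append_singleton, ih, List.countP_append]

theorem degree_nil (s : S) : degree [] s = 0 := rfl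

theorem degree_append (σ τ : List (Finset S)) (s : S) :
    degree (σ ++ τ) s = degree σ s + degree τ s := by
  simp only [degree_eq_countP, List.countP_append]

namespace OnlineRule

variable (A : OnlineRule S)

theorem load_nil (s : S) : A.load [] s = 0 := rfl

theorem load_append_singleton (σ : List (Finset S)) (N : Finset S) (s : S) :
    A.load (σ ++ [N]) s = A.load σ s + if A σ N = some s then 1 else 0 :=
  card_filter_take_append_singleton (fun σ N => A σ N = some s) σ N

theorem load_le_load_append (σ τ : List (Finset S)) (s : S) :
    A.load σ s ≤ A.load (σ ++ τ) s := by
  induction τ using List.reverseRecOn with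
  | nil => simp
  | append_singleton τ N ih =>
    rw [← List.append_assoc, load_append_singleton]
    exact ih.trans (Nat.le_add_right _ _)

variable [Fintype S]

theorem card_filter_output_fst_eq (σ : List (Finset S)) (s : S) :
    ((A.output σ).filter fun e => e.1 = s).card = A.load σ s := by
  have filter_eq : (A.output σ).filter (fun e => e.1 = s) =
      (univ.filter fun t : Fin σ.length => A (σ.take t) σ[t] = some s).map
        (Function.Embedding.sectR s _) := by
    ext ⟨s', t⟩
    simp only [output, mem_filter, mem_univ, true_and, mem_map, Function.Embedding.sectR_apply,
      Prod.mk.injEq, exists_eq_right_right]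
    constructor <;> rintro ⟨h, rfl⟩ <;> exact ⟨h, rfl⟩
  rw [filter_eq, card_map, load]

theorem card_output (σ : List (Finset S)) : (A.output σ).card = ∑ s, A.load σ s := by
  rw [card_eq_sum_card_fiberwise (f := Prod.fst) (t := univ) (fun _ _ => by simp)]
  exact sum_congr rfl fun s _ => A.card_filter_output_fst_eq σ s

theorem sum_load_degree_append_singleton {G : Type*} [AddCommGroup G] {σ : List (Finset S)}
    {N : Finset S} (hA : ∀ s, A σ N = some s → s ∈ N) (f : S → ℕ → ℕ → G) :
    ∑ s, f s (A.load (σ ++ [N]) s) (degree (σ ++ [N]) s) =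
      ∑ s, f s (A.load σ s) (degree σ s) +
        ∑ s ∈ N, (f s (A.load σ s) (degree σ s + 1) - f s (A.load σ s) (degree σ s)) +
        (A σ N).elim 0 fun s =>
          f s (A.load σ s + 1) (degree σ s + 1) - f s (A.load σ s) (degree σ s + 1) := by
  have elim_eq : ∀ g : S → G, (A σ N).elim 0 g = ∑ s, if A σ N = some s then g s else 0 := by
    intro g
    cases A σ N <;> simp
  rw [elim_eq, ← univ_inter N, ← sum_ite_mem, ← sum_add_distrib, ← sum_add_distrib]
  refine sum_congr rfl fun s _ => ?_
  rw [load_append_singleton, degree_append_singleton]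
  by_cases hs : A σ N = some s
  · simp [hs, hA s hs]
  · by_cases hN : s ∈ N <;> simp [hs, hN]

end OnlineRule

theorem opt_le_sum [Fintype S] (b : S → ℕ) (σ : List (Finset S)) : opt b σ ≤ ∑ s, b s := by
  classical
  refine Finset.sup_le fun M hM => ?_
  rw [card_eq_sum_card_fiberwise (f := Prod.fst) (t := univ) (fun _ _ => by simp)]
  exact sum_le_sum fun s _ => (mem_filter.1 hM).2.2.1 s

theorem IsBMatching.card_le_opt [Fintype S] {b : S → ℕ} {σ : List (Finset S)}
    {M : Finset (S × Fin σ.length)} (hM : IsBMatching b σ M) : M.card ≤ opt b σ := by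
  classical
  exact le_sup (f := card) (mem_filter.2 ⟨mem_univ M, hM⟩)

/-- Requests of degree one that complete the degrees in `σ` to those of a `(k,d)`-graph. -/
noncomputable def padding [Fintype S] (k : ℕ) (b : S → ℕ) (σ : List (Finset S)) :
    List (Finset S) :=
  univ.toList.flatMap fun s => List.replicate (k * b s - degree σ s) {s}

theorem exists_of_mem_padding [Fintype S] {k : ℕ} {b : S → ℕ} {σ : List (Finset S)} {N : Finset S}
    (hN : N ∈ padding k b σ) : ∃ s, degree σ s < k * b s ∧ N = {s} := by
  obtain ⟨s, -, hs⟩ := List.mem_flatMap.1 hN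
  obtain ⟨h, rfl⟩ := List.mem_replicate.1 hs
  exact ⟨s, by omega, rfl⟩

theorem degree_padding [Fintype S] (k : ℕ) (b : S → ℕ) (σ : List (Finset S)) (s : S) :
    degree (padding k b σ) s = k * b s - degree σ s := by
  have sum_eq : ((univ : Finset S).toList.map
      fun u => if s = u then k * b u - degree σ u else 0).sum = k * b s - degree σ s := by
    rw [sum_map_toList, sum_ite_eq, if_pos (mem_univ s)]
  rw [degree_eq_countP, padding, List.countP_flatMap, ← sum_eq]
  simp [Function.comp_def, List.countP_replicate]

theorem isKDGraph_append_padding [Fintype S] (k : ℕ) {d : ℕ} (hd : 1 ≤ d) (b : S → ℕ)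
    {σ : List (Finset S)} (hσ : ∀ N ∈ σ, N.card ≤ d) : IsKDGraph k d b (σ ++ padding k b σ) := by
  refine ⟨fun s => ?_, List.forall_mem_append.2 ⟨hσ, fun N hN => ?_⟩⟩
  · rw [degree_append, degree_padding]
    omega
  · obtain ⟨s, -, rfl⟩ := exists_of_mem_padding hN
    rwa [card_singleton]

end Requests

section Feasible

variable {S : Type*} [DecidableEq S]

/-- A rule that, as long as the requests have degree at most `d`, matches a request only to a
neighbour with remaining capacity. The degree bound is part of the notion because only on
`(k,d)`-graphs is an online algorithm required to produce a `b`-matching. -/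
def IsFeasible (d : ℕ) (b : S → ℕ) (A : OnlineRule S) : Prop :=
  ∀ (σ : List (Finset S)) (N : Finset S), (∀ M ∈ σ, M.card ≤ d) → N.card ≤ d →
    ∀ s, A σ N = some s → s ∈ N ∧ A.load σ s < b s

namespace IsFeasible

variable {d : ℕ} {b : S → ℕ} {A : OnlineRule S}

theorem load_le (hA : IsFeasible d b A) {σ : List (Finset S)} (hσ : ∀ N ∈ σ, N.card ≤ d) (s : S) :
    A.load σ s ≤ b s := by
  induction σ using List.reverseRecOn with
  | nil => exact Nat.zero_le _
  | append_singleton σ N ih =>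
    obtain ⟨hσ, hN⟩ := List.forall_mem_append.1 hσ
    rw [A.load_append_singleton]
    split_ifs with h
    · exact (hA σ N hσ (hN N List.mem_cons_self) s h).2
    · exact ih hσ

theorem load_le_degree (hA : IsFeasible d b A) {σ : List (Finset S)} (hσ : ∀ N ∈ σ, N.card ≤ d)
    (s : S) : A.load σ s ≤ degree σ s := by
  induction σ using List.reverseRecOn with
  | nil => exact Nat.zero_le _
  | append_singleton σ N ih =>
    obtain ⟨hσ, hN⟩ := List.forall_mem_append.1 hσ
    rw [A.load_append_singleton, degree_append_singleton]
    by_cases h : A σ N = some s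
    · have := (hA σ N hσ (hN N List.mem_cons_self) s h).1
      simpa [h, this] using ih hσ
    · simpa [h] using (ih hσ).trans (Nat.le_add_right _ _)

theorem load_append_of_forall_notMem (hA : IsFeasible d b A) {σ τ : List (Finset S)}
    (hστ : ∀ N ∈ σ ++ τ, N.card ≤ d) {s : S} (hs : ∀ N ∈ τ, s ∉ N) :
    A.load (σ ++ τ) s = A.load σ s := by
  induction τ using List.reverseRecOn with
  | nil => simp
  | append_singleton τ N ih =>
    rw [← List.append_assoc] at hστ ⊢
    obtain ⟨hτ, hN⟩ := List.forall_mem_append.1 hστ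
    obtain ⟨hs, hsN⟩ := List.forall_mem_append.1 hs
    rw [A.load_append_singleton, ih hτ hs, if_neg, add_zero]
    exact fun h => hsN N List.mem_cons_self (hA _ N hτ (hN N List.mem_cons_self) s h).1

variable [Fintype S]

theorem isBMatching_output (hA : IsFeasible d b A) {σ : List (Finset S)}
    (hσ : ∀ N ∈ σ, N.card ≤ d) : IsBMatching b σ (A.output σ) := by
  refine ⟨fun e he => ?_, fun s => ?_, fun t => card_le_one.2 ?_⟩
  · exact (hA _ _ (fun N hN => hσ N (List.mem_of_mem_take hN)) (hσ _ (List.getElem_mem e.2.2)) _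
      (mem_filter.1 he).2).1
  · rw [A.card_filter_output_fst_eq]
    exact hA.load_le hσ s
  · rintro ⟨s, t⟩ he ⟨s', t'⟩ he'
    simp only [OnlineRule.output, mem_filter, mem_univ, true_and] at he he'
    obtain ⟨he, rfl⟩ := he
    obtain ⟨he', rfl⟩ := he'
    rw [Option.some.inj (he.symm.trans he')]

/-- A violation would persist when the requests are completed to a `(k,d)`-graph. -/
theorem of_isBMatching_output {k : ℕ} (hd : 1 ≤ d)
    (hA : ∀ σ, IsKDGraph k d b σ → IsBMatching b σ (A.output σ)) : IsFeasible d b A := by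
  intro σ N hσ hN s hs
  have hσN : ∀ M ∈ σ ++ [N], M.card ≤ d :=
    List.forall_mem_append.2 ⟨hσ, List.forall_mem_singleton.2 hN⟩
  set τ := padding k b (σ ++ [N])
  obtain ⟨edges, capacity, -⟩ := hA _ (isKDGraph_append_padding k hd b hσN)
  have length_lt : σ.length < (σ ++ [N] ++ τ).length := by simp
  have matched : (s, (⟨σ.length, length_lt⟩ : Fin (σ ++ [N] ++ τ).length)) ∈
      A.output (σ ++ [N] ++ τ) := by
    simp [OnlineRule.output, hs]
  refine ⟨by simpa using edges _ matched, ?_⟩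
  calc A.load σ s < A.load (σ ++ [N]) s := by simp [A.load_append_singleton, hs]
    _ ≤ A.load (σ ++ [N] ++ τ) s := A.load_le_load_append _ _ _
    _ ≤ b s := A.card_filter_output_fst_eq _ s ▸ capacity s

end IsFeasible

end Feasible

/-! ### The weighted assignment algorithm -/

section WeightedAssignment

variable {S : Type*} [DecidableEq S]

/-- The online rule that serves every request by `f`, given the current loads, the earlier requests
and the new request. -/
def ruleOfLoad (f : (S → ℕ) → OnlineRule S) : OnlineRule S := fun σ N =>
  f (fun s => (univ.filter fun t : Fin σ.length =>
    ruleOfLoad f (σ.take t) σ[t] = some s).card) σ N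
termination_by σ => σ.length
decreasing_by all_goals exact (List.length_take_le ..).trans_lt (Fin.is_lt _)

theorem ruleOfLoad_eq (f : (S → ℕ) → OnlineRule S) (σ : List (Finset S)) (N : Finset S) :
    ruleOfLoad f σ N = f ((ruleOfLoad f).load σ) σ N := by
  rw [ruleOfLoad]
  rfl

/-- The rules that WeightedAssignment(VC) may follow on one fixed server set, one for every way of
breaking ties. -/
def IsMaxScoreRule (k d : ℕ) (b : S → ℕ) (A : OnlineRule S) : Prop :=
  ∀ (σ : List (Finset S)) (N : Finset S),
    (eligible b A σ N = ∅ → A σ N = none) ∧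
    ((eligible b A σ N).Nonempty → ∃ s ∈ eligible b A σ N, A σ N = some s ∧
      ∀ s' ∈ eligible b A σ N, score k d b A σ s' ≤ score k d b A σ s)

theorem exists_option_argmax {α β : Type*} [LinearOrder β] (s : Finset α) (g : α → β) :
    ∃ o : Option α, (s = ∅ → o = none) ∧
      (s.Nonempty → ∃ a ∈ s, o = some a ∧ ∀ a' ∈ s, g a' ≤ g a) := by
  rcases s.eq_empty_or_nonempty with rfl | hs
  · exact ⟨none, by simp⟩
  · obtain ⟨a, ha, hmax⟩ := s.exists_max_image g hs
    exact ⟨some a, fun h => absurd h hs.ne_empty, fun _ => ⟨a, ha, rfl, hmax⟩⟩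

theorem exists_isMaxScoreRule (k d : ℕ) (b : S → ℕ) : ∃ A, IsMaxScoreRule k d b A := by
  choose f hf using fun (load : S → ℕ) (σ : List (Finset S)) (N : Finset S) =>
    exists_option_argmax (N.filter fun s => load s < b s) fun s =>
      (b s : ℝ) * (V k d (b s) (load s) (degree σ s + 1) - V k d (b s) (load s) (degree σ s))
  exact ⟨ruleOfLoad f, fun σ N => ruleOfLoad_eq f σ N ▸ hf ((ruleOfLoad f).load σ) σ N⟩

theorem exists_isWeightedAssignmentVC (k d : ℕ) :
    ∃ A : OnlineAlgorithm, IsWeightedAssignmentVC k d A := by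
  choose A hA using fun (n : ℕ) (b : Fin n → ℕ) => exists_isMaxScoreRule k d b
  exact ⟨A, hA⟩

namespace IsMaxScoreRule

variable {k d : ℕ} {b : S → ℕ} {A : OnlineRule S} {σ : List (Finset S)} {N : Finset S}

theorem mem_eligible (hA : IsMaxScoreRule k d b A) {s : S} (hs : A σ N = some s) :
    s ∈ eligible b A σ N := by
  rcases (eligible b A σ N).eq_empty_or_nonempty with h | h
  · simp [(hA σ N).1 h] at hs
  · obtain ⟨s', hs', h', -⟩ := (hA σ N).2 h
    rwa [← Option.some.inj (h'.symm.trans hs)]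

theorem isFeasible (hA : IsMaxScoreRule k d b A) (D : ℕ) : IsFeasible D b A :=
  fun _ _ _ _ _ hs => mem_filter.1 (hA.mem_eligible hs)

theorem score_nonneg (hA : IsMaxScoreRule k d b A) (hk : 1 ≤ k) (hd : 2 ≤ d) (hb : ∀ s, 0 < b s)
    (hσ : ∀ N ∈ σ, N.card ≤ d) (s : S) : 0 ≤ score k d b A σ s :=
  mul_nonneg (Nat.cast_nonneg _) <| sub_nonneg.2 <| V_le_succ_right hk hd (hb s)
    ((hA.isFeasible d).load_le hσ s) ((hA.isFeasible d).load_le_degree hσ s)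

theorem score_eq_zero_of_notMem_eligible (hA : IsMaxScoreRule k d b A) (hd : 2 ≤ d)
    (hσ : ∀ N ∈ σ, N.card ≤ d) {s : S} (hsN : s ∈ N) (hs : s ∉ eligible b A σ N) :
    score k d b A σ s = 0 := by
  have load_eq : A.load σ s = b s := le_antisymm ((hA.isFeasible d).load_le hσ s)
    (not_lt.1 fun h => hs (mem_filter.2 ⟨hsN, h⟩))
  have le_degree : b s ≤ degree σ s := load_eq ▸ (hA.isFeasible d).load_le_degree hσ s
  rw [score, load_eq, V_of_load_eq_capacity hd le_degree,
    V_of_load_eq_capacity hd (le_degree.trans (Nat.le_succ _)), sub_self, mul_zero]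

theorem sum_score_eq_zero (hA : IsMaxScoreRule k d b A) (hd : 2 ≤ d) (hσ : ∀ N ∈ σ, N.card ≤ d)
    (hN : A σ N = none) : ∑ s ∈ N, score k d b A σ s = 0 := by
  have eligible_eq : eligible b A σ N = ∅ := not_nonempty_iff_eq_empty.1 fun h => by
    obtain ⟨s, -, hs, -⟩ := (hA σ N).2 h
    simp [hN] at hs
  exact sum_eq_zero fun s hs =>
    hA.score_eq_zero_of_notMem_eligible hd hσ hs (eligible_eq ▸ notMem_empty s)

theorem sum_score_le (hA : IsMaxScoreRule k d b A) (hk : 1 ≤ k) (hd : 2 ≤ d) (hb : ∀ s, 0 < b s)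
    (hσ : ∀ N ∈ σ, N.card ≤ d) (hN : N.card ≤ d) {s : S} (hs : A σ N = some s) :
    ∑ s' ∈ N, score k d b A σ s' ≤ d * score k d b A σ s := by
  have score_le : ∀ s' ∈ N, score k d b A σ s' ≤ score k d b A σ s := by
    intro s' hs'
    by_cases h : s' ∈ eligible b A σ N
    · obtain ⟨u, -, hu, hmax⟩ := (hA σ N).2 ⟨s', h⟩
      rw [Option.some.inj (hs.symm.trans hu)]
      exact hmax s' h
    · rw [hA.score_eq_zero_of_notMem_eligible hd hσ hs' h]
      exact hA.score_nonneg hk hd hb hσ s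
  calc ∑ s' ∈ N, score k d b A σ s' ≤ N.card * score k d b A σ s := by
        simpa using sum_le_card_nsmul N _ _ score_le
    _ ≤ d * score k d b A σ s := by
        have := hA.score_nonneg hk hd hb hσ s
        gcongr

theorem mul_sum_score_add_le_one (hA : IsMaxScoreRule k d b A) (hk : 1 ≤ k) (hd : 2 ≤ d)
    (hb : ∀ s, 0 < b s) {c : ℝ} (hc : 0 ≤ c) (hσ : ∀ N ∈ σ, N.card ≤ d) (hN : N.card ≤ d) {s : S}
    (hcs : c ≤ cStar k d (b s)) (hs : A σ N = some s) :
    c * (∑ s' ∈ N, score k d b A σ s' + b s *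
      (V k d (b s) (A.load σ s + 1) (degree σ s + 1) -
        V k d (b s) (A.load σ s) (degree σ s + 1))) ≤ 1 := by
  have sum_le := hA.sum_score_le hk hd hb hσ hN hs
  have increment_le := V_succ_succ_sub_add_mul_le hk hd (mem_filter.1 (hA.mem_eligible hs)).2
    ((hA.isFeasible d).load_le_degree hσ s)
  calc _ ≤ c * (1 / cStar k d (b s)) := by
        rw [score] at sum_le
        gcongr
        linarith
    _ ≤ 1 := by
        rw [mul_one_div]
        exact div_le_one_of_le₀ hcs (hc.trans hcs)

variable [Fintype S]

/-- The potential `∑ s, (c * b s * V s - load s)` vanishes initially and never increases. -/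
theorem mul_sum_mul_V_le_sum_load (hA : IsMaxScoreRule k d b A) (hk : 1 ≤ k) (hd : 2 ≤ d)
    (hb : ∀ s, 0 < b s) {c : ℝ} (hc : 0 ≤ c) (hcb : ∀ s, c ≤ cStar k d (b s))
    (hσ : ∀ N ∈ σ, N.card ≤ d) :
    c * ∑ s, (b s : ℝ) * V k d (b s) (A.load σ s) (degree σ s) ≤ ∑ s, (A.load σ s : ℝ) := by
  induction σ using List.reverseRecOn with
  | nil => simp [OnlineRule.load_nil, degree_nil, V_zero_zero hk hd (hb _)]
  | append_singleton σ N ih =>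
    obtain ⟨hσ, hN⟩ := List.forall_mem_append.1 hσ
    have mem_of_eq_some : ∀ s, A σ N = some s → s ∈ N := fun s hs =>
      (mem_filter.1 (hA.mem_eligible hs)).1
    have sum_increment_eq : ∑ s ∈ N, (b s * V k d (b s) (A.load σ s) (degree σ s + 1) -
        b s * V k d (b s) (A.load σ s) (degree σ s)) = ∑ s ∈ N, score k d b A σ s :=
      sum_congr rfl fun s _ => (mul_sub ..).symm
    rw [A.sum_load_degree_append_singleton mem_of_eq_some fun s l δ => (b s : ℝ) * V k d (b s) l δ,
      A.sum_load_degree_append_singleton mem_of_eq_some fun _ l _ => (l : ℝ), sum_increment_eq]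
    cases hs : A σ N with
    | none => simpa [hA.sum_score_eq_zero hd hσ hs] using ih hσ
    | some s =>
      have := hA.mul_sum_score_add_le_one hk hd hb hc hσ (hN N List.mem_cons_self) (hcb s) hs
      simp only [Option.elim_some, Nat.cast_succ, add_sub_cancel_left, sub_self, sum_const_zero]
      linarith [ih hσ]

theorem mul_opt_le_card_output (hA : IsMaxScoreRule k d b A) (hk : 1 ≤ k) (hd : 2 ≤ d)
    (hb : ∀ s, 0 < b s) {c : ℝ} (hc : 0 ≤ c) (hcb : ∀ s, c ≤ cStar k d (b s))
    (hσ : IsKDGraph k d b σ) : c * opt b σ ≤ (A.output σ).card := by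
  calc c * opt b σ ≤ c * ∑ s, (b s : ℝ) := by
        gcongr
        exact_mod_cast opt_le_sum b σ
    _ = c * ∑ s, (b s : ℝ) * V k d (b s) (A.load σ s) (degree σ s) := by
        simp only [V, if_pos (hσ.1 _), mul_one]
    _ ≤ ∑ s, (A.load σ s : ℝ) := hA.mul_sum_mul_V_le_sum_load hk hd hb hc hcb hσ.2
    _ = (A.output σ).card := by rw [A.card_output, Nat.cast_sum]

end IsMaxScoreRule

namespace IsWeightedAssignmentVC

variable {k d : ℕ} {A : OnlineAlgorithm}

theorem isMaxScoreRule (hA : IsWeightedAssignmentVC k d A) (n : ℕ) (b : Fin n → ℕ) :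
    IsMaxScoreRule k d b (A n b) := hA n b

theorem isValid (hA : IsWeightedAssignmentVC k d A) : A.IsValid k d := fun n b _ _ hσ =>
  ((hA.isMaxScoreRule n b).isFeasible d).isBMatching_output hσ.2

theorem inf'_cStar_mul_opt_le (hA : IsWeightedAssignmentVC k d A) (hk : 1 ≤ k) (hd : 2 ≤ d) {n : ℕ}
    [NeZero n] {b : Fin n → ℕ} (hb : ∀ s, 0 < b s) {σ : List (Finset (Fin n))}
    (hσ : IsKDGraph k d b σ) :
    (univ.inf' univ_nonempty fun s => cStar k d (b s)) * opt b σ ≤ ((A n b).output σ).card :=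
  (hA.isMaxScoreRule n b).mul_opt_le_card_output hk hd hb
    (le_inf' _ _ fun s _ => (cStar_pos hk hd (hb s)).le) (fun _ => inf'_le _ (mem_univ _)) hσ

end IsWeightedAssignmentVC

end WeightedAssignment

/-! ### Optimality -/

section MaximumMatching

variable {S : Type*} [DecidableEq S] {b : S → ℕ} {σ : List (Finset S)}

theorem mul_sum_le_mul_card_adjacent {k d : ℕ} (hσ : IsKDGraph k d b σ) (T : Finset S) :
    k * ∑ s ∈ T, b s ≤
      d * (univ.filter fun t : Fin σ.length => ∃ s ∈ T, s ∈ σ[t]).card := by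
  have card_adjacent_le : ∀ t : Fin σ.length,
      (T.filter fun s => s ∈ σ[t]).card ≤ if ∃ s ∈ T, s ∈ σ[t] then d else 0 := by
    intro t
    split_ifs with h
    · exact (card_le_card fun s hs => (mem_filter.1 hs).2).trans (hσ.2 _ (List.getElem_mem t.2))
    · exact (card_eq_zero.2 (filter_eq_empty_iff.2 fun s hs hst => h ⟨s, hs, hst⟩)).le
  calc k * ∑ s ∈ T, b s = ∑ s ∈ T, k * b s := mul_sum _ _ _
    _ ≤ ∑ s ∈ T, degree σ s := sum_le_sum fun s _ => hσ.1 s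
    _ = ∑ t : Fin σ.length, (T.filter fun s => s ∈ σ[t]).card :=
      sum_card_bipartiteAbove_eq_sum_card_bipartiteBelow _
    _ ≤ ∑ t : Fin σ.length, if ∃ s ∈ T, s ∈ σ[t] then d else 0 :=
      sum_le_sum fun t _ => card_adjacent_le t
    _ = _ := by rw [← sum_filter, sum_const, smul_eq_mul, mul_comm]

variable [Fintype S]

theorem isBMatching_image_of_injective {f : (Σ s, Fin (b s)) → Fin σ.length}
    (hf : Function.Injective f) (hfσ : ∀ x, x.1 ∈ σ[f x]) :
    IsBMatching b σ (univ.image fun x => (x.1, f x)) := by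
  refine ⟨fun e he => ?_, fun s => ?_, fun t => card_le_one.2 fun e he e' he' => ?_⟩
  · obtain ⟨x, -, rfl⟩ := mem_image.1 he
    exact hfσ x
  · have subset : (univ.image fun x : Σ s, Fin (b s) => (x.1, f x)).filter (fun e => e.1 = s) ⊆
        (univ : Finset (Fin (b s))).image fun i => (s, f ⟨s, i⟩) := fun e he => by
      obtain ⟨he', rfl⟩ := mem_filter.1 he
      obtain ⟨⟨s, i⟩, -, rfl⟩ := mem_image.1 he'
      exact mem_image_of_mem _ (mem_univ i)
    simpa using (card_le_card subset).trans card_image_le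
  · obtain ⟨⟨x, -, rfl⟩, ht⟩ := by simpa only [mem_filter, mem_image] using he
    obtain ⟨⟨y, -, rfl⟩, ht'⟩ := by simpa only [mem_filter, mem_image] using he'
    rw [hf (ht.trans ht'.symm)]

theorem sum_le_opt_of_hall
    (hall : ∀ T : Finset S,
      ∑ s ∈ T, b s ≤ (univ.filter fun t : Fin σ.length => ∃ s ∈ T, s ∈ σ[t]).card) :
    ∑ s, b s ≤ opt b σ := by
  set adjacent : (Σ s, Fin (b s)) → Finset (Fin σ.length) := fun x =>
    univ.filter fun t => x.1 ∈ σ[t] with hadjacent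
  have card_le : ∀ C : Finset (Σ s, Fin (b s)), C.card ≤ (C.biUnion adjacent).card := by
    intro C
    have subset : C ⊆ (C.image Sigma.fst).sigma fun _ => univ := fun x hx =>
      mem_sigma.2 ⟨mem_image_of_mem _ hx, mem_univ _⟩
    have biUnion_eq : C.biUnion adjacent =
        univ.filter fun t : Fin σ.length => ∃ s ∈ C.image Sigma.fst, s ∈ σ[t] := by
      ext t
      simp [hadjacent]
    calc C.card ≤ ∑ s ∈ C.image Sigma.fst, b s := by simpa using card_le_card subset
      _ ≤ (C.biUnion adjacent).card := biUnion_eq ▸ hall (C.image Sigma.fst)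
  obtain ⟨f, hf, hfσ⟩ := (all_card_le_biUnion_card_iff_exists_injective adjacent).1 card_le
  have matching := isBMatching_image_of_injective hf fun x => (mem_filter.1 (hfσ x)).2
  calc ∑ s, b s = (univ.image fun x => (x.1, f x)).card := by
        rw [card_image_of_injective _ fun x y h => hf (congrArg Prod.snd h)]
        simp
    _ ≤ opt b σ := matching.card_le_opt

theorem opt_eq_sum {k d : ℕ} (hk : 1 ≤ k) (hdk : d ≤ k) (hσ : IsKDGraph k d b σ) :
    opt b σ = ∑ s, b s :=
  le_antisymm (opt_le_sum b σ) <| sum_le_opt_of_hall fun T => Nat.le_of_mul_le_mul_left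
    ((mul_sum_le_mul_card_adjacent hσ T).trans (Nat.mul_le_mul_right _ hdk)) hk

end MaximumMatching

section Adversary

variable {S : Type*} [DecidableEq S] [Fintype S] {k d : ℕ} {b : S → ℕ} {A : OnlineRule S}
  {σ : List (Finset S)}

/-- The total load after the requests `σ`, plus the load that the servers still gain if the
adversary can go on as in `adversaryPotential_append_singleton_le` until all degrees are
complete. -/
noncomputable def adversaryPotential (k d : ℕ) (b : S → ℕ) (A : OnlineRule S)
    (σ : List (Finset S)) : ℝ :=
  ∑ s, ((A.load σ s : ℝ) + gain (1 / d) (b s - A.load σ s) (k * b s - degree σ s))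

theorem adversaryPotential_nil :
    adversaryPotential k d b A [] = ∑ s, gain (1 / d) (b s) (k * b s) := by
  simp [adversaryPotential, OnlineRule.load_nil, degree_nil]

theorem adversaryPotential_append_singleton_le (hd : 2 ≤ d) (hA : IsFeasible d b A)
    (hσ : ∀ N ∈ σ, N.card ≤ d) {T : Finset S} (hT : T.card = d) {β l δ : ℕ} (hδ : δ < k * β)
    (hstate : ∀ s ∈ T, (b s, A.load σ s, degree σ s) = (β, l, δ)) :
    adversaryPotential k d b A (σ ++ [T]) ≤ adversaryPotential k d b A σ := by
  obtain ⟨hp, hp1⟩ := one_div_natCast_mem_Ioo hd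
  obtain ⟨n, hn⟩ : ∃ n, k * β - δ = n + 1 := ⟨k * β - δ - 1, by omega⟩
  have hn' : k * β - (δ + 1) = n := by omega
  have sum_increment_eq : ∑ s ∈ T,
      (((A.load σ s : ℝ) + gain (1 / d) (b s - A.load σ s) (k * b s - (degree σ s + 1))) -
        (A.load σ s + gain (1 / d) (b s - A.load σ s) (k * b s - degree σ s))) =
      d * (gain (1 / d) (β - l) n - gain (1 / d) (β - l) (n + 1)) := by
    rw [← hT, ← nsmul_eq_mul, ← sum_const]
    refine sum_congr rfl fun s hs => ?_
    obtain ⟨rfl, rfl, rfl⟩ := by simpa only [Prod.mk.injEq] using hstate s hs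
    rw [hn, hn', add_sub_add_left_eq_sub]
  rw [adversaryPotential, A.sum_load_degree_append_singleton
    (fun s hs => (hA σ T hσ hT.le s hs).1)
    fun s l δ => (l : ℝ) + gain (1 / d) (b s - l) (k * b s - δ), sum_increment_eq,
    ← adversaryPotential]
  cases hs : A σ T with
  | none =>
    have := mul_nonneg d.cast_nonneg
      (sub_nonneg.2 (gain_le_succ_right hp.le hp1.le (β - l) n))
    simp only [Option.elim_none]
    linarith
  | some s =>
    obtain ⟨hsT, load_lt⟩ := hA σ T hσ hT.le s hs
    obtain ⟨rfl, rfl, rfl⟩ := by simpa only [Prod.mk.injEq] using hstate s hsT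
    obtain ⟨m, hm⟩ : ∃ m, b s - A.load σ s = m + 1 := ⟨b s - A.load σ s - 1, by omega⟩
    rw [Option.elim_some, hn', show b s - (A.load σ s + 1) = m by omega, hm, Nat.cast_succ]
    linarith [natCast_mul_gain_succ_succ (by omega : d ≠ 0) m n]

/-- The servers of incomplete degree with a given capacity, load and degree. -/
def incompleteServers (k : ℕ) (b : S → ℕ) (A : OnlineRule S) (σ : List (Finset S))
    (x : ℕ × ℕ × ℕ) : Finset S :=
  univ.filter fun s => degree σ s < k * b s ∧ (b s, A.load σ s, degree σ s) = x

theorem exists_forall_card_incompleteServers_lt (k : ℕ) (hd : 2 ≤ d) (hA : IsFeasible d b A) :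
    ∃ σ : List (Finset S), (∀ N ∈ σ, N.card ≤ d) ∧
      adversaryPotential k d b A σ ≤ adversaryPotential k d b A [] ∧
      ∀ x, (incompleteServers k b A σ x).card < d := by
  obtain ⟨σ, ⟨hσ, potential_le⟩, minimal⟩ :=
    exists_minimalFor_of_wellFoundedLT
      (fun σ : List (Finset S) => (∀ N ∈ σ, N.card ≤ d) ∧
        adversaryPotential k d b A σ ≤ adversaryPotential k d b A [])
      (fun σ => ∑ s, (k * b s - degree σ s)) ⟨[], by simp, le_rfl⟩
  refine ⟨σ, hσ, potential_le, ?_⟩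
  by_contra! hx
  obtain ⟨⟨β, l, δ⟩, hx⟩ := hx
  obtain ⟨T, hTx, hT⟩ := exists_subset_card_eq hx
  have mem_T : ∀ s ∈ T, degree σ s < k * b s ∧ (b s, A.load σ s, degree σ s) = (β, l, δ) :=
    fun s hs => (mem_filter.1 (hTx hs)).2
  obtain ⟨s, hs⟩ : T.Nonempty := card_pos.1 (by omega)
  have hδ : δ < k * β := by
    obtain ⟨degree_lt, state_eq⟩ := mem_T s hs
    simpa [(Prod.mk.inj state_eq).1, (Prod.mk.inj (Prod.mk.inj state_eq).2).2] using degree_lt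
  have missing_lt : ∑ s, (k * b s - degree (σ ++ [T]) s) < ∑ s, (k * b s - degree σ s) := by
    simp only [degree_append_singleton]
    refine sum_lt_sum (fun s _ => by omega) ⟨s, mem_univ s, ?_⟩
    have := (mem_T s hs).1
    rw [if_pos hs]
    omega
  refine missing_lt.not_ge (minimal ⟨List.forall_mem_append.2 ⟨hσ, by simp [hT]⟩, ?_⟩ missing_lt.le)
  exact (adversaryPotential_append_singleton_le hd hA hσ hT hδ fun s hs => (mem_T s hs).2).trans
    potential_le

theorem card_filter_degree_lt_le (hA : IsFeasible d b A) (hσ : ∀ N ∈ σ, N.card ≤ d) {β D : ℕ}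
    (hβ : ∀ s, b s ≤ β) (hD : ∀ x, (incompleteServers k b A σ x).card ≤ D) :
    (univ.filter fun s => degree σ s < k * b s).card ≤
      D * ((β + 1) * ((β + 1) * (k * β + 1))) := by
  have mapsTo : ∀ s ∈ univ.filter fun s => degree σ s < k * b s,
      (b s, A.load σ s, degree σ s) ∈
        range (β + 1) ×ˢ range (β + 1) ×ˢ range (k * β + 1) := by
    intro s hs
    have degree_lt := (mem_filter.1 hs).2.trans_le (Nat.mul_le_mul_left k (hβ s))
    have load_le := (hA.load_le hσ s).trans (hβ s)
    have := hβ s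
    simp only [mem_product, mem_range]
    omega
  simpa using card_le_mul_card_image_of_maps_to mapsTo D fun x _ => by
    rw [filter_filter]
    exact hD x

theorem card_output_append_padding_le (hd : 2 ≤ d) (hA : IsFeasible d b A)
    (hσ : ∀ N ∈ σ, N.card ≤ d) {β : ℕ} (hβ : ∀ s, b s ≤ β) :
    ((A.output (σ ++ padding k b σ)).card : ℝ) ≤ adversaryPotential k d b A σ +
      ((univ.filter fun s => degree σ s < k * b s).card * β : ℕ) := by
  obtain ⟨hp, hp1⟩ := one_div_natCast_mem_Ioo hd
  have hστ := (isKDGraph_append_padding k (by omega : 1 ≤ d) b hσ).2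
  have load_le : ∀ s, (A.load (σ ++ padding k b σ) s : ℝ) ≤
      ((A.load σ s : ℝ) + gain (1 / d) (b s - A.load σ s) (k * b s - degree σ s)) +
        if degree σ s < k * b s then (β : ℝ) else 0 := by
    intro s
    have gain_nonneg := gain_nonneg hp.le hp1.le (b s - A.load σ s) (k * b s - degree σ s)
    split_ifs with hs
    · have : (A.load (σ ++ padding k b σ) s : ℝ) ≤ β :=
        Nat.cast_le.2 ((hA.load_le hστ s).trans (hβ s))
      linarith [(A.load σ s).cast_nonneg (α := ℝ)]
    · have notMem_padding : ∀ N ∈ padding k b σ, s ∉ N := by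
        intro N hN hsN
        obtain ⟨u, hu, rfl⟩ := exists_of_mem_padding hN
        exact hs (mem_singleton.1 hsN ▸ hu)
      rw [hA.load_append_of_forall_notMem hστ notMem_padding]
      linarith
  rw [A.card_output, Nat.cast_sum, Nat.cast_mul, ← nsmul_eq_mul, ← sum_const, sum_filter,
    adversaryPotential, ← sum_add_distrib]
  exact sum_le_sum fun s _ => load_le s

/-- The error does not depend on the number of servers, since fewer than `d` servers of incomplete
degree are left in each of the boundedly many states. -/
theorem exists_isKDGraph_card_output_le (k : ℕ) (hd : 2 ≤ d) (hA : IsFeasible d b A) {β : ℕ}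
    (hβ : ∀ s, b s ≤ β) :
    ∃ σ : List (Finset S), IsKDGraph k d b σ ∧
      ((A.output σ).card : ℝ) ≤ ∑ s, gain (1 / d) (b s) (k * b s) +
        (d * ((β + 1) * ((β + 1) * (k * β + 1))) * β : ℕ) := by
  obtain ⟨σ, hσ, potential_le, card_lt⟩ := exists_forall_card_incompleteServers_lt k hd hA
  refine ⟨σ ++ padding k b σ, isKDGraph_append_padding k (by omega) b hσ, ?_⟩
  refine (card_output_append_padding_le hd hA hσ hβ).trans ?_
  have := card_filter_degree_lt_le hA hσ hβ fun x => (card_lt x).le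
  rw [← adversaryPotential_nil (A := A)]
  gcongr

end Adversary

section Optimality

theorem exists_capacities {B : Finset ℕ} {β : ℕ} (hβ : β ∈ B) (N : ℕ) :
    ∃ (n : ℕ) (b : Fin n → ℕ), univ.image b = B ∧
      ∀ F : ℕ → ℝ, ∑ s, F (b s) = ∑ β' ∈ B, F β' + N * F β := by
  set l := B.toList ++ List.replicate N β with hl
  have mem_l : ∀ x, x ∈ l ↔ x ∈ B := fun x => by
    rw [hl, List.mem_append, mem_toList, or_iff_left_of_imp]
    exact fun hx => List.eq_of_mem_replicate hx ▸ hβ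
  refine ⟨l.length, fun i => l[i], ?_, fun F => ?_⟩
  · ext x
    simp [← mem_l, List.mem_iff_get]
  · exact (Fin.sum_univ_fun_getElem l F).trans (by simp [hl])

theorem le_of_forall_natCast_mul_le_add {R : Type*} [Field R] [LinearOrder R]
    [IsStrictOrderedRing R] [Archimedean R] {a b C : R} (h : ∀ N : ℕ, N * a ≤ N * b + C) :
    a ≤ b := by
  by_contra! hlt
  obtain ⟨N, hN⟩ := exists_lt_nsmul (sub_pos.2 hlt) C
  rw [nsmul_eq_mul, mul_sub] at hN
  linarith [h N]

theorem OnlineAlgorithm.IsCompetitiveOn.le_cStar_min' {k d : ℕ} (hk : 1 ≤ k) (hd : 2 ≤ d)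
    (hdk : d ≤ k) {B : Finset ℕ} (hB : B.Nonempty) (hpos : ∀ β ∈ B, 0 < β) {A : OnlineAlgorithm}
    (hA : A.IsValid k d) {c : ℝ} (hc : A.IsCompetitiveOn k d B c) :
    c ≤ cStar k d (B.min' hB) := by
  set β := B.min' hB
  have hβ : β ∈ B := B.min'_mem hB
  set M := B.max' hB
  refine le_of_mul_le_mul_left ?_ (Nat.cast_pos.2 (hpos β hβ) : (0 : ℝ) < β)
  rw [mul_cStar k hd (hpos β hβ)]
  refine le_of_forall_natCast_mul_le_add (C := ∑ β' ∈ B, gain (1 / d) β' (k * β') +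
    (d * ((M + 1) * ((M + 1) * (k * M + 1))) * M : ℕ) - c * ∑ β' ∈ B, (β' : ℝ)) fun N => ?_
  obtain ⟨n, b, image_eq, sum_eq⟩ := exists_capacities hβ N
  have mem_B : ∀ s, b s ∈ B := fun s => image_eq ▸ mem_image_of_mem b (mem_univ s)
  have feasible : IsFeasible d b (A _ b) :=
    .of_isBMatching_output (by omega) (hA _ b fun s => hpos _ (mem_B s))
  obtain ⟨σ, hσ, card_le⟩ := exists_isKDGraph_card_output_le k hd feasible
    (β := M) fun s => B.le_max' _ (mem_B s)
  have competitive := (hc _ b image_eq σ hσ).trans card_le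
  rw [opt_eq_sum hk hdk hσ, Nat.cast_sum, sum_eq fun x => (x : ℝ),
    sum_eq fun x => gain (1 / d) x (k * x)] at competitive
  linarith

end Optimality

end KDMatching

theorem mainTheorem4 (k d : ℕ) (hk : 1 ≤ k) (hd : 2 ≤ d) :
    -- the algorithm exists
    (∃ A : KDMatching.OnlineAlgorithm, KDMatching.IsWeightedAssignmentVC k d A) ∧
    -- however ties are broken, it outputs `b`-matchings and is `min_s c*_s`-competitive
    (∀ A : KDMatching.OnlineAlgorithm, KDMatching.IsWeightedAssignmentVC k d A →
      A.IsValid k d ∧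
      ∀ (n : ℕ) [NeZero n] (b : Fin n → ℕ), (∀ s, 0 < b s) →
        ∀ σ : List (Finset (Fin n)), KDMatching.IsKDGraph k d b σ →
          (Finset.univ.inf' Finset.univ_nonempty fun s => KDMatching.cStar k d (b s)) *
              (KDMatching.opt b σ : ℝ) ≤
            (((A n b).output σ).card : ℝ)) ∧
    -- this ratio is `c*` for the smallest capacity
    (∀ (n : ℕ) [NeZero n] (b : Fin n → ℕ), (∀ s, 0 < b s) →
      (Finset.univ.inf' Finset.univ_nonempty fun s => KDMatching.cStar k d (b s)) =
        KDMatching.cStar k d (Finset.univ.inf' Finset.univ_nonempty b)) ∧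
    -- optimality: for no set of capacities does a deterministic online algorithm do better
    (d ≤ k →
      ∀ (B : Finset ℕ) (hB : B.Nonempty), (∀ β ∈ B, 0 < β) →
        ∀ A : KDMatching.OnlineAlgorithm, A.IsValid k d →
          ∀ c : ℝ, A.IsCompetitiveOn k d B c → c ≤ KDMatching.cStar k d (B.min' hB)) := by
  refine ⟨KDMatching.exists_isWeightedAssignmentVC k d, fun A hA => ⟨hA.isValid, ?_⟩, ?_, ?_⟩
  · intro n _ b hb σ hσ
    exact hA.inf'_cStar_mul_opt_le hk hd hb hσ
  · intro n _ b hb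
    exact KDMatching.inf'_cStar hk hd _ fun s _ => hb s
  · intro hdk B hB hpos A hA c hc
    exact hc.le_cStar_min' hk hd hdk hB hpos hA
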